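/- Let $p_0\ge 1$, let $\boldsymbol{\alpha}$ be a probability vector of length $p_0$ (a row vector), and let $A$ be a real $p_0\times p_0$ matrix such that \[\Lambda=\begin{pmatrix}0&\mathbf 0\\ -A\mathbf 1&A\end{pmatrix}\] is the generator of a time-homogeneous Markov jump process on $\{\star\}\cup\{1,\dots,p_0\}$ in which $\star$ is absorbing and the states $1,\dots,p_0$ are all transient. Let $Y\sim\mathrm{PH}(\boldsymbol{\alpha},A)$, that is, $Y$ is a real random variable distributed as $\inf\{t\ge 0:\varphi(t)=\star\}$, where $\varphi$ is a Markov jump process with generator $\Lambda$ and initial distribution $(0\mid\boldsymbol{\alpha})$. Let $-\sigma_0$ be the dominant eigenvalue of $A$, i.e. its eigenvalue with the largest real part (which is real and negative), and let $\nu_0=\max_{1\le i\le p_0}(-A\mathbf 1)_i$. Fix $\nu\in[\nu_0,\infty)$, $p\in\{p_0,p_0+1,p_0+2,\dots\}$ and $\sigma\in(0,\sigma_0]$. Then \[L\le_{\mathrm{st}}Y\le_{\mathrm{st}}H,\] where $L\sim\mathrm{Exp}(\nu)$ and $H\sim\mathrm{Erlang}(p,\sigma)$ (density $\sigma^p x^{p-1}e^{-\sigma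 x}/(p-1)!$ on $[0,\infty)$), and $X_1\le_{\mathrm{st}}X_2$ means that $P(X_1>x)\le P(X_2>x)$ for all $x$. -/

import Mathlib

open MeasureTheory ProbabilityTheory Filter Topology
open scoped NNReal

universe w

namespace PhaseType

/-- The exit-rate vector `-A𝟏` of a square matrix `A`: the rates from the states of `A` to the
absorbing state. -/
def exitRate {p : ℕ} (A : Matrix (Fin p) (Fin p) ℝ) (i : Fin p) : ℝ :=
  -∑ j, A i j

/-- The matrix `[[0, 0], [-A𝟏, A]]` on the state space `{⋆} ∪ {1, …, p}`. The absorbing state `⋆`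
is `none`, the other states are `some i`. -/
def generator {p : ℕ} (A : Matrix (Fin p) (Fin p) ℝ) :
    Matrix (Option (Fin p)) (Option (Fin p)) ℝ :=
  fun x y =>
    match x, y with
    | none, _ => 0
    | some i, none => exitRate A i
    | some i, some j => A i j

/-- The row vector `[0 | α]` on `{⋆} ∪ {1, …, p}`. -/
def initialVector {p : ℕ} (α : Fin p → ℝ) : Option (Fin p) → ℝ
  | none => 0
  | some i => α i

/-- The state `i` is transient for the Markov jump process with generator `Q`: starting from `i`,
the expected total time spent in `i`, namely `∫₀^∞ (e^{tQ})_{ii} dt`, is finite. -/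
def IsTransientState {E : Type*} [Fintype E] [DecidableEq E] (Q : Matrix E E ℝ) (i : E) : Prop :=
  IntegrableOn (fun t : ℝ => NormedSpace.exp (t • Q) i i) (Set.Ioi 0) volume

/-- `A` is a sub-generator: the rates between distinct states of the process with generator
`[[0, 0], [-A𝟏, A]]` are nonnegative (its rows sum to zero by construction), and all the states
other than `⋆` are transient. -/
structure IsSubGenerator {p : ℕ} (A : Matrix (Fin p) (Fin p) ℝ) : Prop where
  rate_nonneg : ∀ i j, i ≠ j → 0 ≤ A i j
  exitRate_nonneg : ∀ i, 0 ≤ exitRate A i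
  transient : ∀ i : Fin p, IsTransientState (generator A) (some i)

/-- `φ` is a time-homogeneous Markov jump process on the finite set `E` with initial
distribution `π` and generator `Q`: it is measurable, its paths are right-continuous for the
discrete topology on `E`, and its finite-dimensional distributions are
`P(φ(t₀) = i₀, …, φ(tₙ) = iₙ) = π(i₀) ∏ₖ (e^{(tₖ₊₁ - tₖ)Q})(iₖ, iₖ₊₁)` for
`0 = t₀ ≤ t₁ ≤ … ≤ tₙ`. -/
structure IsMarkovJumpProcess {E : Type*} [Fintype E] [DecidableEq E]
    {Ω : Type*} [MeasurableSpace Ω] (P : Measure Ω)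
    (π : E → ℝ) (Q : Matrix E E ℝ) (φ : ℝ≥0 → Ω → E) : Prop where
  measurableSet_eq : ∀ t i, MeasurableSet {ω | φ t ω = i}
  right_continuous : ∀ ω t, ∀ᶠ s in 𝓝[≥] t, φ s ω = φ t ω
  finite_dim : ∀ (n : ℕ) (t : Fin (n + 1) → ℝ≥0) (i : Fin (n + 1) → E),
    t 0 = 0 → Monotone t →
      P.real {ω | ∀ k, φ (t k) ω = i k} =
        π (i 0) * ∏ k : Fin n,
          NormedSpace.exp (((t k.succ : ℝ) - (t k.castSucc : ℝ)) • Q) (i k.castSucc) (i k.succ)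

/-- The time `inf {t ≥ 0 | φ(t) = ⋆}` before absorption; it is `⊤` if `⋆` is never reached. -/
noncomputable def absorptionTime {p : ℕ} {Ω : Type*} (φ : ℝ≥0 → Ω → Option (Fin p)) (ω : Ω) :
    EReal :=
  sInf {x : EReal | ∃ t : ℝ≥0, φ t ω = none ∧ x = ((t : ℝ) : EReal)}

/-- `Y ∼ PH(α, A)`: the vector `α` is a probability vector, `A` is a sub-generator, and `Y` is
distributed as the time before absorption of a Markov jump process with initial distribution
`[0 | α]` and generator `[[0, 0], [-A𝟏, A]]`. -/
structure IsPhaseType {p : ℕ} (α : Fin p → ℝ) (A : Matrix (Fin p) (Fin p) ℝ)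
    {Ω : Type*} [MeasurableSpace Ω] (Y : Ω → ℝ) (P : Measure Ω) : Prop where
  initial_nonneg : ∀ i, 0 ≤ α i
  initial_sum : ∑ i, α i = 1
  subGenerator : IsSubGenerator A
  law : ∃ (Ω' : Type w) (_ : MeasurableSpace Ω') (P' : Measure Ω') (_ : IsProbabilityMeasure P')
    (φ : ℝ≥0 → Ω' → Option (Fin p)),
    IsMarkovJumpProcess P' (initialVector α) (generator A) φ ∧
      IdentDistrib (fun ω => (Y ω : EReal)) (absorptionTime φ) P P'

/-- `z` is a dominant eigenvalue of the real matrix `A`: a complex eigenvalue of `A` with the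
largest real part. -/
def IsDominantEigenvalue {p : ℕ} (A : Matrix (Fin p) (Fin p) ℝ) (z : ℂ) : Prop :=
  Module.End.HasEigenvalue (Matrix.toLin' (A.map Complex.ofReal)) z ∧
    ∀ y : ℂ, Module.End.HasEigenvalue (Matrix.toLin' (A.map Complex.ofReal)) y → y.re ≤ z.re

/-- The Erlang distribution with `p` phases and rate `σ`, of density
`σ^p x^(p-1) e^(-σx) / (p-1)!` on `[0, ∞)`. -/
noncomputable def erlangMeasure (p : ℕ) (σ : ℝ) : Measure ℝ :=
  gammaMeasure (p : ℝ) σ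

/-- The usual stochastic order `X ≤_st Y` of two random variables, possibly defined on different
probability spaces: `P(X > x) ≤ P(Y > x)` for all `x`. -/
def StochLE {Ω₁ : Type*} {Ω₂ : Type*} [MeasurableSpace Ω₁] [MeasurableSpace Ω₂]
    (X : Ω₁ → ℝ) (P₁ : Measure Ω₁) (Y : Ω₂ → ℝ) (P₂ : Measure Ω₂) : Prop :=
  ∀ x : ℝ, P₁ {ω | x < X ω} ≤ P₂ {ω | x < Y ω}

end PhaseType

/-!
The survival function of `Y` is `α e^{tA} 𝟏`, so both bounds amount to comparing `e^{tA} 𝟏`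
entrywise with a scalar function. As `A` has nonnegative off-diagonal entries, `e^{tA}` is
nonnegative, and `e^{tA} w(0)` is dominated by (dominates) every supersolution (subsolution) `w` of
`w' = A w`.

For the lower bound, `t ↦ e^{-νt} 𝟏` is a subsolution, because the exit rates are at most `ν`.

For the upper bound, first let `v` be a positive vector with `A v ≤ -σ v`, and let
`0 = x₀ < x₁ < ⋯ < x_m` with `x₁, …, x_m` the distinct values of `v`. The pure death chain
`m → ⋯ → 1 → 0` whose rates make `(x₁, …, x_m)` an eigenvector with eigenvalue `-σ` has all its
rates at least `σ`, so its survival functions `f_k` are bounded by that of the Erlang distribution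
with `m ≤ p₀` phases. At each time the points `(x_k, f_k)` form a concave nondecreasing graph; by
concavity, `f_j ≤ f_k + s (x_j - x_k)` with `s ≥ 0` the slope of the chord ending at `x_k`, which
turns `A v ≤ -σ v` and `A 𝟏 ≤ 0` into the statement that `i ↦ f_k`, for `v i = x_k`, is a
supersolution. A vector `v` as required exists for every `σ < σ₀`, namely `(-σ - A)⁻¹ 𝟏`, and the
case `σ = σ₀` follows by continuity.
-/

namespace PhaseType

open NormedSpace (exp)
open scoped Matrix

section Metzler

variable {ι : Type*} {A : Matrix ι ι ℝ}

/-- A real square matrix is Metzler if its off-diagonal entries are nonnegative. -/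
def IsMetzler (A : Matrix ι ι ℝ) : Prop :=
  ∀ i j, i ≠ j → 0 ≤ A i j

lemma IsMetzler.smul (hA : IsMetzler A) {c : ℝ} (hc : 0 ≤ c) : IsMetzler (c • A) :=
  fun i j hij => mul_nonneg hc (hA i j hij)

lemma IsMetzler.add_smul_one [DecidableEq ι] (hA : IsMetzler A) (c : ℝ) :
    IsMetzler (A + c • (1 : Matrix ι ι ℝ)) :=
  fun i j hij => by simpa [hij] using hA i j hij

lemma IsMetzler.exists_nonneg_add_smul_one [Finite ι] [DecidableEq ι] (hA : IsMetzler A) :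
    ∃ c : ℝ, ∀ i j, 0 ≤ (A + c • (1 : Matrix ι ι ℝ)) i j := by
  obtain ⟨c, hc⟩ := (Set.finite_range fun i => -A i i).bddAbove
  refine ⟨c, fun i j => ?_⟩
  obtain rfl | hij := eq_or_ne i j
  · have := hc ⟨i, rfl⟩
    simp only [Matrix.add_apply, Matrix.smul_apply, Matrix.one_apply_eq, smul_eq_mul, mul_one]
    linarith
  · exact hA.add_smul_one c i j hij

variable [Fintype ι]

lemma IsMetzler.nonneg_of_mulVec_neg (hA : IsMetzler A) (hA1 : A *ᵥ 1 ≤ 0) {v : ι → ℝ}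
    (hv : ∀ i, (A *ᵥ v) i < 0) : 0 ≤ v := by
  intro i
  obtain ⟨k, -, hk⟩ := Finset.exists_min_image Finset.univ v ⟨i, Finset.mem_univ i⟩
  refine le_trans ?_ (hk i (Finset.mem_univ i))
  by_contra! hneg
  have hrow : v k * (A *ᵥ 1) k ≤ (A *ᵥ v) k := by
    simp only [Matrix.mulVec, dotProduct, Finset.mul_sum, Pi.one_apply, mul_one]
    refine Finset.sum_le_sum fun j _ => ?_
    obtain rfl | hkj := eq_or_ne k j
    · exact (mul_comm _ _).le
    · rw [mul_comm]
      exact mul_le_mul_of_nonneg_left (hk j (Finset.mem_univ j)) (hA k j hkj)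
  exact (hv k).not_ge ((mul_nonneg_of_nonpos_of_nonpos hneg.le (hA1 k)).trans hrow)

lemma IsMetzler.pos_of_nonneg_of_mulVec_neg (hA : IsMetzler A) {v : ι → ℝ} (hv0 : 0 ≤ v)
    (hv : ∀ i, (A *ᵥ v) i < 0) (i : ι) : 0 < v i := by
  refine (hv0 i).lt_of_ne fun hi => (hv i).not_ge (Finset.sum_nonneg fun j _ => ?_)
  obtain rfl | hij := eq_or_ne i j
  · simp [← hi]
  · exact mul_nonneg (hA i j hij) (hv0 j)

lemma mulVec_mono_of_nonneg (hA : ∀ i j, 0 ≤ A i j) {u v : ι → ℝ} (huv : u ≤ v) :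
    A *ᵥ u ≤ A *ᵥ v :=
  fun i => Finset.sum_le_sum fun j _ => mul_le_mul_of_nonneg_left (huv j) (hA i j)

variable [DecidableEq ι]

lemma pow_apply_nonneg (hA : ∀ i j, 0 ≤ A i j) (n : ℕ) (i j : ι) : 0 ≤ (A ^ n) i j := by
  induction n generalizing j with
  | zero => simp only [pow_zero, Matrix.one_apply]; positivity
  | succ n ih =>
    rw [pow_succ, Matrix.mul_apply]
    exact Finset.sum_nonneg fun k _ => mul_nonneg (ih k) (hA k j)

open scoped Matrix.Norms.Operator

lemma exp_apply_nonneg (hA : ∀ i j, 0 ≤ A i j) (i j : ι) : 0 ≤ exp A i j := by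
  have hsum := (Matrix.entryLinearMap ℝ ℝ i j).toContinuousLinearMap.hasSum
    (NormedSpace.exp_series_hasSum_exp' (𝕂 := ℝ) A)
  exact hsum.nonneg fun n => mul_nonneg (by positivity) (pow_apply_nonneg hA n i j)

lemma exp_add_smul_one (A : Matrix ι ι ℝ) (c : ℝ) :
    exp (A + c • (1 : Matrix ι ι ℝ)) = Real.exp c • exp A := by
  have hexp : exp (c • (1 : Matrix ι ι ℝ)) = Real.exp c • 1 := by
    rw [Matrix.smul_one_eq_diagonal, Matrix.exp_diagonal, Pi.exp_def, ← Real.exp_eq_exp_ℝ,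
      ← Matrix.smul_one_eq_diagonal]
  rw [Matrix.exp_add_of_commute _ _ ((Commute.one_right A).smul_right c), hexp, Matrix.mul_smul,
    mul_one]

lemma IsMetzler.exp_apply_nonneg (hA : IsMetzler A) (i j : ι) : 0 ≤ exp A i j := by
  obtain ⟨c, hc⟩ := hA.exists_nonneg_add_smul_one
  have h := PhaseType.exp_apply_nonneg hc i j
  rw [exp_add_smul_one] at h
  exact nonneg_of_mul_nonneg_right h (Real.exp_pos c)

lemma hasDerivAt_exp_smul_apply (A : Matrix ι ι ℝ) (t : ℝ) (i j : ι) :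
    HasDerivAt (fun s : ℝ => exp (s • A) i j) ((exp (t • A) * A) i j) t :=
  (Matrix.entryLinearMap ℝ ℝ i j).toContinuousLinearMap.hasFDerivAt.comp_hasDerivAt t
    (hasDerivAt_exp_smul_const A t)

lemma hasDerivAt_exp_sub_smul_mulVec_apply (A : Matrix ι ι ℝ) {w : ℝ → ι → ℝ} {w' : ι → ℝ}
    {s : ℝ} (hw : HasDerivAt w w' s) (t : ℝ) (i : ι) :
    HasDerivAt (fun r => (exp ((t - r) • A) *ᵥ w r) i)
      ((exp ((t - s) • A) *ᵥ (w' - A *ᵥ w s)) i) s := by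
  have hexp (j : ι) : HasDerivAt (fun r => exp ((t - r) • A) i j)
      (-(exp ((t - s) • A) * A) i j) s := by
    simpa using (hasDerivAt_exp_smul_apply A (t - s) i j).comp_const_sub t s
  refine (HasDerivAt.fun_sum fun j _ => (hexp j).mul (hasDerivAt_pi.1 hw j)).congr_deriv ?_
  rw [Finset.sum_add_distrib, Matrix.mulVec_sub, Matrix.mulVec_mulVec, Pi.sub_apply]
  simp only [neg_mul, Finset.sum_neg_distrib, neg_add_eq_sub]
  rfl

theorem IsMetzler.exp_smul_mulVec_le (hA : IsMetzler A) {w w' : ℝ → ι → ℝ}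
    (hw : ∀ s, 0 ≤ s → HasDerivAt w (w' s) s) (hle : ∀ s, 0 ≤ s → A *ᵥ w s ≤ w' s)
    {t : ℝ} (ht : 0 ≤ t) : exp (t • A) *ᵥ w 0 ≤ w t := by
  intro i
  have hderiv (s : ℝ) (hs : 0 ≤ s) := hasDerivAt_exp_sub_smul_mulVec_apply A (hw s hs) t i
  have hmono : MonotoneOn (fun s => (exp ((t - s) • A) *ᵥ w s) i) (Set.Icc 0 t) := by
    refine monotoneOn_of_hasDerivWithinAt_nonneg (convex_Icc 0 t)
      (fun s hs => (hderiv s hs.1).continuousAt.continuousWithinAt)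
      (fun s hs => (hderiv s (interior_subset hs).1).hasDerivWithinAt) fun s hs => ?_
    have hs' := interior_subset hs
    simpa using mulVec_mono_of_nonneg
      (hA.smul (sub_nonneg.2 hs'.2)).exp_apply_nonneg (sub_nonneg.2 (hle s hs'.1)) i
  simpa using hmono (Set.left_mem_Icc.2 ht) (Set.right_mem_Icc.2 ht) ht

theorem IsMetzler.le_exp_smul_mulVec (hA : IsMetzler A) {w w' : ℝ → ι → ℝ}
    (hw : ∀ s, 0 ≤ s → HasDerivAt w (w' s) s) (hle : ∀ s, 0 ≤ s → w' s ≤ A *ᵥ w s)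
    {t : ℝ} (ht : 0 ≤ t) : w t ≤ exp (t • A) *ᵥ w 0 := by
  have h := hA.exp_smul_mulVec_le (w := fun s => -w s) (fun s hs => (hw s hs).neg)
    (fun s hs => by simpa only [Matrix.mulVec_neg, neg_le_neg_iff] using hle s hs) ht
  simpa only [Matrix.mulVec_neg, neg_le_neg_iff] using h

theorem IsMetzler.exp_neg_mul_le_exp_smul_mulVec_one (hA : IsMetzler A) {ν : ℝ}
    (hν : ∀ i, -ν ≤ (A *ᵥ 1) i) {t : ℝ} (ht : 0 ≤ t) (i : ι) :
    Real.exp (-(ν * t)) ≤ (exp (t • A) *ᵥ 1) i := by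
  have hderiv (s : ℝ) : HasDerivAt (fun s => Real.exp (-(ν * s)) • (1 : ι → ℝ))
      ((Real.exp (-(ν * s)) * -ν) • (1 : ι → ℝ)) s := by
    simpa using ((((hasDerivAt_id s).const_mul ν).neg).exp).smul_const (1 : ι → ℝ)
  have h := hA.le_exp_smul_mulVec (fun s _ => hderiv s) (fun s _ j => ?_) ht i
  · simpa using h
  · simpa [Matrix.mulVec_smul] using mul_le_mul_of_nonneg_left (hν j) (Real.exp_pos _).le

end Metzler

section LinearComparison

lemma nonneg_of_neg_mul_le_deriv {g g' : ℝ → ℝ} (hg : ∀ s, HasDerivAt g (g' s) s) (c : ℝ)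
    (hle : ∀ s, 0 ≤ s → -(c * g s) ≤ g' s) (h0 : 0 ≤ g 0) {t : ℝ} (ht : 0 ≤ t) : 0 ≤ g t := by
  have hderiv (s : ℝ) : HasDerivAt (fun s => Real.exp (c * s) * g s)
      (Real.exp (c * s) * (c * g s + g' s)) s :=
    ((((hasDerivAt_id s).const_mul c).exp).mul (hg s)).congr_deriv (by simp only [id]; ring)
  have hmono : MonotoneOn (fun s => Real.exp (c * s) * g s) (Set.Ici 0) :=
    monotoneOn_of_hasDerivWithinAt_nonneg (convex_Ici 0)
      (fun s _ => (hderiv s).continuousAt.continuousWithinAt)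
      (fun s _ => (hderiv s).hasDerivWithinAt) fun s hs =>
        mul_nonneg (Real.exp_pos _).le (by linarith [hle s (interior_subset hs)])
  have h := hmono Set.self_mem_Ici ht ht
  simp only [mul_zero, Real.exp_zero, one_mul] at h
  exact nonneg_of_mul_nonneg_right (h0.trans h) (Real.exp_pos _)

end LinearComparison

section SecantSlope

variable {𝕜 : Type*} [Field 𝕜]

/-- The slope of the `k`-th chord of the planar points `(x k, f k)`. -/
def secantSlope (x f : ℕ → 𝕜) (k : ℕ) : 𝕜 :=
  (f (k + 1) - f k) / (x (k + 1) - x k)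

variable {x f : ℕ → 𝕜}

lemma secantSlope_mul_sub {k : ℕ} (hk : x (k + 1) ≠ x k) :
    secantSlope x f k * (x (k + 1) - x k) = f (k + 1) - f k :=
  div_mul_cancel₀ _ (sub_ne_zero.2 hk)

variable [LinearOrder 𝕜] [IsStrictOrderedRing 𝕜]

lemma le_add_secantSlope_mul_sub (hx : StrictMono x) (hf : Antitone (secantSlope x f)) (j k : ℕ) :
    f j ≤ f (k + 1) + secantSlope x f k * (x j - x (k + 1)) := by
  have hstep (l : ℕ) : f (l + 1) - secantSlope x f k * x (l + 1) -
      (f l - secantSlope x f k * x l) =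
        (secantSlope x f l - secantSlope x f k) * (x (l + 1) - x l) := by
    rw [sub_mul, secantSlope_mul_sub (hx l.lt_succ_self).ne']
    ring
  have hgap (l : ℕ) : 0 ≤ x (l + 1) - x l := sub_nonneg.2 (hx l.lt_succ_self).le
  suffices f j - secantSlope x f k * x j ≤ f (k + 1) - secantSlope x f k * x (k + 1) by
    linarith
  rcases le_total j (k + 1) with hj | hj
  · refine Nat.decreasingInduction' (P := fun l => f l - secantSlope x f k * x l ≤ _)
      (fun l hl _ ih => ?_) hj le_rfl
    have := mul_nonneg (sub_nonneg.2 (hf (Nat.lt_succ_iff.1 hl))) (hgap l)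
    linarith [hstep l]
  · induction j, hj using Nat.le_induction with
    | base => exact le_rfl
    | succ l hl ih =>
      have := mul_nonpos_of_nonpos_of_nonneg
        (sub_nonpos.2 (hf ((Nat.le_succ k).trans hl))) (hgap l)
      linarith [hstep l]

end SecantSlope

section Hypoexponential

/-- The survival function of the time at which the pure death chain on `ℕ` with rate `r k` from
`k + 1` to `k`, started at `k`, reaches `0`; it is a sum of `k` independent exponential times. The
recursion conditions on the first jump. -/
noncomputable def hypoexpSurvival (r : ℕ → ℝ) : ℕ → ℝ → ℝ
  | 0, _ => 0
  | k + 1, t => Real.exp (-(r k * t)) *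
      (1 + ∫ s in 0..t, r k * Real.exp (r k * s) * hypoexpSurvival r k s)

lemma hasDerivAt_exp_neg_mul_integral {f : ℝ → ℝ} (hf : Continuous f) (c t : ℝ) :
    HasDerivAt (fun t => Real.exp (-(c * t)) * (1 + ∫ s in 0..t, c * Real.exp (c * s) * f s))
      (-(c * (Real.exp (-(c * t)) * (1 + ∫ s in 0..t, c * Real.exp (c * s) * f s) - f t))) t := by
  have hint : HasDerivAt (fun t => ∫ s in 0..t, c * Real.exp (c * s) * f s)
      (c * Real.exp (c * t) * f t) t :=
    ((by fun_prop : Continuous fun s => c * Real.exp (c * s) * f s).integral_hasStrictDerivAt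
      0 t).hasDerivAt
  have hexp : Real.exp (-(c * t)) * Real.exp (c * t) = 1 := by
    rw [← Real.exp_add, neg_add_cancel, Real.exp_zero]
  refine (((((hasDerivAt_id t).const_mul c).neg).exp).mul (hint.const_add 1)).congr_deriv ?_
  simp only [id]
  linear_combination c * f t * hexp

variable (r : ℕ → ℝ)

lemma continuous_hypoexpSurvival : ∀ k, Continuous (hypoexpSurvival r k)
  | 0 => continuous_const
  | k + 1 => continuous_iff_continuousAt.2 fun t =>
    (hasDerivAt_exp_neg_mul_integral (continuous_hypoexpSurvival k) (r k) t).continuousAt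

lemma hasDerivAt_hypoexpSurvival_succ (k : ℕ) (t : ℝ) :
    HasDerivAt (hypoexpSurvival r (k + 1))
      (-(r k * (hypoexpSurvival r (k + 1) t - hypoexpSurvival r k t))) t :=
  hasDerivAt_exp_neg_mul_integral (continuous_hypoexpSurvival r k) (r k) t

lemma hypoexpSurvival_zero_left (t : ℝ) : hypoexpSurvival r 0 t = 0 := rfl

lemma hypoexpSurvival_succ_zero (k : ℕ) : hypoexpSurvival r (k + 1) 0 = 1 := by
  simp [hypoexpSurvival]

variable {r}

lemma monotone_hypoexpSurvival (hr : ∀ k, 0 ≤ r k) {t : ℝ} (ht : 0 ≤ t) :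
    Monotone fun k => hypoexpSurvival r k t := by
  refine monotone_nat_of_le_succ fun k => sub_nonneg.1 ?_
  induction k generalizing t with
  | zero => simpa [hypoexpSurvival] using (Real.exp_pos _).le
  | succ k ih =>
    refine nonneg_of_neg_mul_le_deriv (fun s => (hasDerivAt_hypoexpSurvival_succ r (k + 1) s).sub
      (hasDerivAt_hypoexpSurvival_succ r k s)) (r (k + 1)) (fun s hs => ?_) ?_ ht
    · simpa using mul_nonneg (hr k) (ih hs)
    · simp [hypoexpSurvival_succ_zero]

end Hypoexponential

section Erlang

open scoped Nat

/-- The survival function of the Erlang distribution with `p` phases and rate `σ`. -/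
noncomputable def erlangSurvival (p : ℕ) (σ t : ℝ) : ℝ :=
  Real.exp (-(σ * t)) * ∑ k ∈ Finset.range p, (σ * t) ^ k / k !

lemma erlangSurvival_zero_left (σ t : ℝ) : erlangSurvival 0 σ t = 0 := by
  simp [erlangSurvival]

lemma erlangSurvival_succ_zero (p : ℕ) (σ : ℝ) : erlangSurvival (p + 1) σ 0 = 1 := by
  simp [erlangSurvival, Finset.sum_range_succ']

lemma erlangSurvival_succ (p : ℕ) (σ t : ℝ) :
    erlangSurvival (p + 1) σ t =
      erlangSurvival p σ t + Real.exp (-(σ * t)) * ((σ * t) ^ p / p !) := by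
  rw [erlangSurvival, Finset.sum_range_succ, mul_add, erlangSurvival]

lemma erlangSurvival_mono {σ t : ℝ} (hσ : 0 ≤ σ) (ht : 0 ≤ t) :
    Monotone fun p => erlangSurvival p σ t :=
  monotone_nat_of_le_succ fun p => by
    rw [erlangSurvival_succ]
    exact le_add_of_nonneg_right (by positivity)

lemma hasDerivAt_erlangSurvival_succ (p : ℕ) (σ t : ℝ) :
    HasDerivAt (erlangSurvival (p + 1) σ)
      (-(σ * (erlangSurvival (p + 1) σ t - erlangSurvival p σ t))) t := by
  have hlin : HasDerivAt (fun s => σ * s) σ t := by simpa using (hasDerivAt_id t).const_mul σ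
  have hexp : HasDerivAt (fun s => Real.exp (-(σ * s))) (Real.exp (-(σ * t)) * -σ) t := hlin.neg.exp
  have hsucc (p : ℕ) : erlangSurvival (p + 1) σ = fun s =>
      erlangSurvival p σ s + Real.exp (-(σ * s)) * ((σ * s) ^ p / p !) :=
    funext (erlangSurvival_succ p σ)
  induction p with
  | zero => simpa [hsucc, erlangSurvival_zero_left, mul_comm σ] using hexp
  | succ p ih =>
    rw [hsucc (p + 1)]
    refine (ih.add (hexp.mul ((hlin.fun_pow (p + 1)).div_const _))).congr_deriv ?_
    simp only [hsucc p]
    push_cast [Nat.factorial_succ, Nat.add_sub_cancel]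
    field_simp
    ring

lemma hypoexpSurvival_le_erlangSurvival {r : ℕ → ℝ} {σ : ℝ} (hσ : 0 ≤ σ) (hr : ∀ k, σ ≤ r k)
    (k : ℕ) {t : ℝ} (ht : 0 ≤ t) : hypoexpSurvival r k t ≤ erlangSurvival k σ t := by
  induction k generalizing t with
  | zero => exact (erlangSurvival_zero_left σ t).ge
  | succ k ih =>
    refine sub_nonneg.1 (nonneg_of_neg_mul_le_deriv (fun s =>
      (hasDerivAt_erlangSurvival_succ k σ s).sub (hasDerivAt_hypoexpSurvival_succ r k s)) σ
        (fun s hs => ?_) ?_ ht)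
    · have hmono := monotone_hypoexpSurvival (fun k => hσ.trans (hr k)) hs k.le_succ
      have hrate := mul_le_mul_of_nonneg_right (hr k) (sub_nonneg.2 hmono)
      have hprev := mul_le_mul_of_nonneg_left (ih hs) hσ
      simp only [Pi.sub_apply, Nat.succ_eq_add_one] at hrate ⊢
      linarith
    · simp [hypoexpSurvival_succ_zero, erlangSurvival_succ_zero]

end Erlang

section EigenRate

/-- The rates `r` of the hypoexponential chain that has `(x 1, x 2, …)` as an eigenvector with
eigenvalue `-σ`, that is, `r k * (x k - x (k + 1)) = -σ * x (k + 1)`. -/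
noncomputable def eigenRate (σ : ℝ) (x : ℕ → ℝ) (k : ℕ) : ℝ :=
  σ * x (k + 1) / (x (k + 1) - x k)

variable {σ : ℝ} {x : ℕ → ℝ}

lemma le_eigenRate (hσ : 0 ≤ σ) (hx : StrictMono x) (hx0 : x 0 = 0) (k : ℕ) :
    σ ≤ eigenRate σ x k := by
  rw [eigenRate, le_div_iff₀ (sub_pos.2 (hx k.lt_succ_self))]
  have : 0 ≤ x k := hx0 ▸ hx.monotone k.zero_le
  exact mul_le_mul_of_nonneg_left (sub_le_self _ this) hσ

/-- The chord slopes of the points `(x k, f k t)`, where `f k` is the survival function of the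
chain with rates `eigenRate σ x` started at `k`. -/
noncomputable def hypoexpSlope (σ : ℝ) (x : ℕ → ℝ) (k : ℕ) (t : ℝ) : ℝ :=
  secantSlope x (fun j => hypoexpSurvival (eigenRate σ x) j t) k

lemma hasDerivAt_hypoexpSurvival_eigenRate (σ : ℝ) (x : ℕ → ℝ) (k : ℕ) (t : ℝ) :
    HasDerivAt (hypoexpSurvival (eigenRate σ x) (k + 1)) (-(σ * x (k + 1) * hypoexpSlope σ x k t))
      t :=
  (hasDerivAt_hypoexpSurvival_succ _ k t).congr_deriv <| by
    rw [eigenRate, hypoexpSlope, secantSlope, div_mul_comm, mul_comm (_ / _)]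

lemma hypoexpSlope_nonneg (hσ : 0 ≤ σ) (hx : StrictMono x) (hx0 : x 0 = 0) (k : ℕ) {t : ℝ}
    (ht : 0 ≤ t) : 0 ≤ hypoexpSlope σ x k t :=
  div_nonneg (sub_nonneg.2 (monotone_hypoexpSurvival (fun k => hσ.trans (le_eigenRate hσ hx hx0 k))
    ht k.le_succ)) (sub_nonneg.2 (hx k.lt_succ_self).le)

lemma hasDerivAt_hypoexpSlope_zero (hx : StrictMono x) (hx0 : x 0 = 0) (t : ℝ) :
    HasDerivAt (hypoexpSlope σ x 0) (-(σ * hypoexpSlope σ x 0 t)) t := by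
  have hx1 : x 1 ≠ 0 := hx0 ▸ (hx Nat.zero_lt_one).ne'
  have hslope : hypoexpSlope σ x 0 = fun s => hypoexpSurvival (eigenRate σ x) 1 s / x 1 := by
    funext s
    simp [hypoexpSlope, secantSlope, hx0, hypoexpSurvival_zero_left]
  have h := (hasDerivAt_hypoexpSurvival_eigenRate σ x 0 t).div_const (x 1)
  rw [zero_add, ← hslope] at h
  exact h.congr_deriv (by field_simp)

lemma hasDerivAt_hypoexpSlope_succ (hx : StrictMono x) (k : ℕ) (t : ℝ) :
    HasDerivAt (hypoexpSlope σ x (k + 1))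
      (-(σ * hypoexpSlope σ x (k + 1) t) + σ * x (k + 1) / (x (k + 2) - x (k + 1)) *
        (hypoexpSlope σ x k t - hypoexpSlope σ x (k + 1) t)) t := by
  have hgap : x (k + 2) - x (k + 1) ≠ 0 := sub_ne_zero.2 (hx (k + 1).lt_succ_self).ne'
  refine (((hasDerivAt_hypoexpSurvival_eigenRate σ x (k + 1) t).sub
    (hasDerivAt_hypoexpSurvival_eigenRate σ x k t)).div_const _).congr_deriv ?_
  field_simp
  ring

lemma hypoexpSlope_succ_zero (k : ℕ) : hypoexpSlope σ x (k + 1) 0 = 0 := by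
  simp [hypoexpSlope, secantSlope, hypoexpSurvival_succ_zero]

-- The differences of consecutive slopes solve a cooperative linear system.
lemma antitone_hypoexpSlope (hσ : 0 ≤ σ) (hx : StrictMono x) (hx0 : x 0 = 0) {t : ℝ} (ht : 0 ≤ t) :
    Antitone fun k => hypoexpSlope σ x k t := by
  have hcoeff (k : ℕ) : 0 ≤ σ * x (k + 1) / (x (k + 2) - x (k + 1)) :=
    div_nonneg (mul_nonneg hσ (hx0 ▸ hx.monotone (Nat.zero_le _)))
      (sub_nonneg.2 (hx.monotone (Nat.le_succ _)))
  refine antitone_nat_of_succ_le fun k => sub_nonneg.1 ?_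
  induction k generalizing t with
  | zero =>
    refine nonneg_of_neg_mul_le_deriv (fun s => (hasDerivAt_hypoexpSlope_zero hx hx0 s).sub
      (hasDerivAt_hypoexpSlope_succ hx 0 s)) (σ + σ * x 1 / (x 2 - x 1)) (fun s _ => ?_) ?_ ht
    · simp only [Pi.sub_apply, zero_add]
      linarith
    · simpa [hypoexpSlope_succ_zero] using hypoexpSlope_nonneg hσ hx hx0 0 le_rfl
  | succ k ih =>
    refine nonneg_of_neg_mul_le_deriv (fun s => (hasDerivAt_hypoexpSlope_succ hx k s).sub
      (hasDerivAt_hypoexpSlope_succ hx (k + 1) s))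
        (σ + σ * x (k + 2) / (x (k + 3) - x (k + 2))) (fun s hs => ?_) ?_ ht
    · have := mul_nonneg (hcoeff k) (ih hs)
      simp only [Pi.sub_apply]
      linarith
    · simp [hypoexpSlope_succ_zero]

end EigenRate

section UpperBound

lemma exists_strictMono_enumeration {β : Type*} [LinearOrder β] [NoMaxOrder β] (s : Finset β)
    {a : β} (ha : ∀ b ∈ s, a < b) :
    ∃ x : ℕ → β, StrictMono x ∧ x 0 = a ∧ ∀ b ∈ s, ∃ k < s.card, x (k + 1) = b := by
  induction s using Finset.induction_on_min generalizing a with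
  | empty => simpa using Nat.exists_strictMono' a
  | insert b s hb ih =>
    obtain ⟨x, hx, hx0, hxs⟩ := ih hb
    refine ⟨fun n => n.casesOn a x, strictMono_nat_of_lt_succ fun n => ?_, rfl, fun c hc => ?_⟩
    · cases n with
      | zero => simpa [hx0] using ha b (Finset.mem_insert_self b s)
      | succ n => exact hx n.lt_succ_self
    · rw [Finset.card_insert_of_notMem fun h => (hb b h).false]
      obtain rfl | hcs := Finset.mem_insert.1 hc
      · exact ⟨0, Nat.succ_pos _, hx0⟩
      · obtain ⟨k, hk, rfl⟩ := hxs c hcs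
        exact ⟨k + 1, Nat.succ_lt_succ hk, rfl⟩

variable {ι : Type*} [Fintype ι] {A : Matrix ι ι ℝ} {σ t : ℝ}

lemma IsMetzler.mulVec_hypoexpSurvival_le (hA : IsMetzler A) (hA1 : A *ᵥ 1 ≤ 0) (hσ : 0 ≤ σ)
    {x : ℕ → ℝ} (hx : StrictMono x) (hx0 : x 0 = 0) (κ : ι → ℕ)
    (hAx : A *ᵥ (fun i => x (κ i + 1)) ≤ -σ • fun i => x (κ i + 1)) (ht : 0 ≤ t) (i : ι) :
    (A *ᵥ fun j => hypoexpSurvival (eigenRate σ x) (κ j + 1) t) i ≤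
      -(σ * x (κ i + 1) * hypoexpSlope σ x (κ i) t) := by
  set f := fun k => hypoexpSurvival (eigenRate σ x) k t with hf
  set s := hypoexpSlope σ x (κ i) t
  have htangent (j : ℕ) : f j ≤ f (κ i + 1) + s * (x j - x (κ i + 1)) :=
    le_add_secantSlope_mul_sub hx (antitone_hypoexpSlope hσ hx hx0 ht) j (κ i)
  have hs : 0 ≤ s := hypoexpSlope_nonneg hσ hx hx0 (κ i) ht
  have hintercept : 0 ≤ f (κ i + 1) - s * x (κ i + 1) := by
    have := htangent 0
    simp only [hf, hypoexpSurvival_zero_left, hx0] at this ⊢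
    linarith
  calc ∑ j, A i j * f (κ j + 1)
      ≤ ∑ j, A i j * (f (κ i + 1) - s * x (κ i + 1) + s * x (κ j + 1)) := by
        refine Finset.sum_le_sum fun j _ => ?_
        obtain rfl | hij := eq_or_ne i j
        · simp
        · exact mul_le_mul_of_nonneg_left (by linarith [htangent (κ j + 1)]) (hA i j hij)
    _ = (f (κ i + 1) - s * x (κ i + 1)) * (A *ᵥ 1) i + s * (A *ᵥ fun j => x (κ j + 1)) i := by
        simp only [Matrix.mulVec, dotProduct, Finset.mul_sum, ← Finset.sum_add_distrib,
          Pi.one_apply]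
        exact Finset.sum_congr rfl fun j _ => by ring
    _ ≤ 0 + s * (-σ * x (κ i + 1)) :=
        add_le_add (mul_nonpos_of_nonneg_of_nonpos hintercept (hA1 i))
          (mul_le_mul_of_nonneg_left (hAx i) hs)
    _ = -(σ * x (κ i + 1) * s) := by ring

variable [DecidableEq ι]

-- On the distinct values of `v`, the survival functions of the chain with rates `eigenRate σ x`
-- form a supersolution of `w' = A w`, and each of its rates is at least `σ`.
theorem IsMetzler.exp_smul_mulVec_one_le_erlangSurvival (hA : IsMetzler A) (hA1 : A *ᵥ 1 ≤ 0)
    (hσ : 0 ≤ σ) {v : ι → ℝ} (hv : ∀ i, 0 < v i) (hAv : A *ᵥ v ≤ -σ • v) (ht : 0 ≤ t) (i : ι) :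
    (exp (t • A) *ᵥ 1) i ≤ erlangSurvival (Fintype.card ι) σ t := by
  obtain ⟨x, hx, hx0, hxv⟩ := exists_strictMono_enumeration (Finset.univ.image v) (a := 0)
    (by simpa using hv)
  choose κ hκ hxκ using fun i => hxv (v i) (Finset.mem_image_of_mem v (Finset.mem_univ i))
  obtain rfl : (fun i => x (κ i + 1)) = v := funext hxκ
  have hcomparison := hA.exp_smul_mulVec_le
    (w := fun s i => hypoexpSurvival (eigenRate σ x) (κ i + 1) s)
    (fun s _ => hasDerivAt_pi.2 fun i => hasDerivAt_hypoexpSurvival_eigenRate σ x (κ i) s)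
    (fun s hs => hA.mulVec_hypoexpSurvival_le hA1 hσ hx hx0 κ hAv hs) ht i
  calc (exp (t • A) *ᵥ 1) i
      ≤ hypoexpSurvival (eigenRate σ x) (κ i + 1) t := by
        simpa only [hypoexpSurvival_succ_zero, ← Pi.one_def] using hcomparison
    _ ≤ erlangSurvival (κ i + 1) σ t :=
        hypoexpSurvival_le_erlangSurvival hσ (le_eigenRate hσ hx hx0) _ ht
    _ ≤ erlangSurvival (Fintype.card ι) σ t :=
        erlangSurvival_mono hσ ht ((hκ i).trans_le Finset.card_image_le)

end UpperBound

section PositiveVector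

lemma forall_pos_of_continuousOn {X ι : Type*} [TopologicalSpace X] [Finite ι] {s : Set X}
    (hs : IsPreconnected s) {v : X → ι → ℝ} (hv : ContinuousOn v s)
    (hpos : ∀ r ∈ s, 0 ≤ v r → ∀ i, 0 < v r i) {r₀ : X} (hr₀ : r₀ ∈ s) (h₀ : 0 ≤ v r₀) {r : X}
    (hr : r ∈ s) (i : ι) : 0 < v r i := by
  let U : Set (ι → ℝ) := {w | ∀ i, 0 < w i}
  let V : Set (ι → ℝ) := {w | ∃ i, w i < 0}
  have hU : IsOpen U := by
    simp only [U, Set.ofPred_forall]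
    exact isOpen_iInter_of_finite fun i => isOpen_lt continuous_const (continuous_apply i)
  have hV : IsOpen V := by
    simp only [V, Set.ofPred_exists]
    exact isOpen_iUnion fun i => isOpen_lt (continuous_apply i) continuous_const
  have hUV : Disjoint U V :=
    Set.disjoint_left.2 fun w hwU ⟨i, hi⟩ => (hwU i).not_gt hi
  have hcover : v '' s ⊆ U ∪ V := by
    rintro _ ⟨r, hr, rfl⟩
    by_cases h : 0 ≤ v r
    · exact Or.inl (hpos r hr h)
    · rw [Pi.le_def, not_forall] at h
      exact Or.inr (h.imp fun i hi => not_le.1 hi)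
  exact (hs.image v hv).subset_left_of_subset_union hU hV hUV hcover
    ⟨v r₀, ⟨r₀, hr₀, rfl⟩, hpos r₀ hr₀ h₀⟩ ⟨r, hr, rfl⟩ i

variable {ι : Type*} [Fintype ι] [DecidableEq ι] {A : Matrix ι ι ℝ}

lemma exists_le_sub_scalar_mulVec_one_nonpos (A : Matrix ι ι ℝ) (ρ : ℝ) :
    ∃ r, ρ ≤ r ∧ (A - Matrix.scalar ι r) *ᵥ 1 ≤ 0 := by
  obtain ⟨c, hc⟩ := (Set.finite_range (A *ᵥ 1)).bddAbove
  refine ⟨max ρ c, le_max_left _ _, fun i => ?_⟩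
  have : (A *ᵥ 1) i ≤ max ρ c := (hc ⟨i, rfl⟩).trans (le_max_right _ _)
  simpa [Matrix.sub_mulVec] using this

lemma continuousOn_inv_scalar_sub_mulVec {s : Set ℝ} (hs : ∀ r ∈ s, ¬A.charpoly.IsRoot r)
    (u : ι → ℝ) : ContinuousOn (fun r => (Matrix.scalar ι r - A)⁻¹ *ᵥ u) s := by
  have hscalar : Continuous fun r => Matrix.scalar ι r - A := by
    simp only [Matrix.scalar_apply]
    fun_prop
  have hdet : ContinuousOn (fun r => Ring.inverse (Matrix.scalar ι r - A).det) s := by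
    simp only [Ring.inverse_eq_inv']
    refine hscalar.matrix_det.continuousOn.inv₀ fun r hr => ?_
    rw [← Matrix.eval_charpoly]
    exact hs r hr
  simp only [Matrix.inv_def]
  exact (continuous_id.matrix_mulVec continuous_const).comp_continuousOn
    (hdet.smul hscalar.matrix_adjugate.continuousOn)

-- Increase `r` until the resolvent vector `(r - A)⁻¹ 1` is positive; as `r` decreases to `ρ`, no
-- entry can vanish while the others stay nonnegative.
theorem IsMetzler.exists_pos_mulVec_le (hA : IsMetzler A) {ρ : ℝ}
    (hρ : ∀ r, ρ ≤ r → ¬A.charpoly.IsRoot r) :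
    ∃ v : ι → ℝ, (∀ i, 0 < v i) ∧ A *ᵥ v ≤ ρ • v := by
  let v (r : ℝ) : ι → ℝ := (Matrix.scalar ι r - A)⁻¹ *ᵥ 1
  have hMetzler (r : ℝ) : IsMetzler (A - Matrix.scalar ι r) := by
    simpa [Matrix.scalar_apply, ← Matrix.smul_one_eq_diagonal, sub_eq_add_neg] using
      hA.add_smul_one (-r)
  have hresolvent (r : ℝ) (hr : ρ ≤ r) : (A - Matrix.scalar ι r) *ᵥ v r = -1 := by
    have hdet : IsUnit (Matrix.scalar ι r - A).det := by
      rw [← Matrix.eval_charpoly]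
      exact isUnit_iff_ne_zero.2 (hρ r hr)
    rw [← neg_sub, Matrix.neg_mulVec, Matrix.mulVec_mulVec, Matrix.mul_nonsing_inv _ hdet,
      Matrix.one_mulVec]
  have hneg (r : ℝ) (hr : ρ ≤ r) (i : ι) : ((A - Matrix.scalar ι r) *ᵥ v r) i < 0 := by
    rw [hresolvent r hr]
    exact neg_one_lt_zero
  obtain ⟨r₀, hr₀, hsum⟩ := exists_le_sub_scalar_mulVec_one_nonpos A ρ
  refine ⟨v ρ, fun i => forall_pos_of_continuousOn isPreconnected_Ici
    (continuousOn_inv_scalar_sub_mulVec hρ 1)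
    (fun r hr hvr => (hMetzler r).pos_of_nonneg_of_mulVec_neg hvr (hneg r hr)) hr₀
    ((hMetzler r₀).nonneg_of_mulVec_neg hsum (hneg r₀ hr₀)) Set.self_mem_Ici i, fun i => ?_⟩
  simpa [Matrix.sub_mulVec] using (hneg ρ le_rfl i).le

lemma hasEigenvalue_ofReal_of_isRoot_charpoly {r : ℝ} (hr : A.charpoly.IsRoot r) :
    Module.End.HasEigenvalue (Matrix.toLin' (A.map Complex.ofReal)) r := by
  rw [Module.End.hasEigenvalue_iff_isRoot_charpoly, Matrix.charpoly_toLin',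
    show A.map Complex.ofReal = A.map Complex.ofRealHom from rfl, Matrix.charpoly_map]
  exact hr.map

-- The positive vector exists for every rate below `σ`; the bound passes to the limit.
theorem IsMetzler.exp_smul_mulVec_one_le_erlangSurvival_of_charpoly (hA : IsMetzler A)
    (hA1 : A *ᵥ 1 ≤ 0) {σ : ℝ} (hσ : 0 < σ) (hroot : ∀ r, -σ < r → ¬A.charpoly.IsRoot r) {t : ℝ}
    (ht : 0 ≤ t) (i : ι) : (exp (t • A) *ᵥ 1) i ≤ erlangSurvival (Fintype.card ι) σ t := by
  have hcont : Continuous fun s => erlangSurvival (Fintype.card ι) s t := by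
    unfold erlangSurvival
    fun_prop
  refine ge_of_tendsto (hcont.continuousWithinAt (s := Set.Iio σ) (x := σ)).tendsto ?_
  filter_upwards [Ioo_mem_nhdsLT hσ] with s hs
  obtain ⟨v, hv, hAv⟩ := hA.exists_pos_mulVec_le
    fun r hr => hroot r ((neg_lt_neg hs.2).trans_le hr)
  exact hA.exp_smul_mulVec_one_le_erlangSurvival hA1 hs.1.le hv hAv ht i

end PositiveVector

section SubGenerator

variable {p : ℕ} {A : Matrix (Fin p) (Fin p) ℝ}

lemma mulVec_one_apply_eq_neg_exitRate (A : Matrix (Fin p) (Fin p) ℝ) (i : Fin p) :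
    (A *ᵥ 1) i = -exitRate A i := by
  simp [exitRate, Matrix.mulVec, dotProduct]

lemma IsSubGenerator.isMetzler (hA : IsSubGenerator A) : IsMetzler A := hA.rate_nonneg

lemma IsSubGenerator.mulVec_one_nonpos (hA : IsSubGenerator A) : A *ᵥ 1 ≤ 0 := fun i => by
  simpa [mulVec_one_apply_eq_neg_exitRate] using hA.exitRate_nonneg i

lemma IsDominantEigenvalue.not_isRoot_charpoly {z : ℂ} (hz : IsDominantEigenvalue A z) {r : ℝ}
    (hr : z.re < r) : ¬A.charpoly.IsRoot r := fun hroot =>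
  hr.not_ge (by simpa using hz.2 r (hasEigenvalue_ofReal_of_isRoot_charpoly hroot))

lemma exists_exitRate_ne_zero [NeZero p] (h0 : ¬A.charpoly.IsRoot 0) : ∃ i, exitRate A i ≠ 0 := by
  by_contra! h
  refine h0 ?_
  rw [Polynomial.IsRoot, Matrix.eval_charpoly, map_zero, ← Matrix.exists_mulVec_eq_zero_iff]
  refine ⟨1, one_ne_zero, funext fun i => ?_⟩
  rw [zero_sub, Matrix.neg_mulVec, Pi.neg_apply, mulVec_one_apply_eq_neg_exitRate, h, neg_neg,
    Pi.zero_apply]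

end SubGenerator

section ErlangMeasure

open scoped Nat

lemma tendsto_erlangSurvival_atTop (p : ℕ) {σ : ℝ} (hσ : 0 < σ) :
    Tendsto (erlangSurvival p σ) atTop (𝓝 0) := by
  have hterm (k : ℕ) : Tendsto (fun x : ℝ => Real.exp (-x) * (x ^ k / k !)) atTop (𝓝 0) := by
    have h := (Real.tendsto_pow_mul_exp_neg_atTop_nhds_zero k).div_const (k ! : ℝ)
    rw [zero_div] at h
    exact h.congr fun x => by ring
  have hsum := tendsto_finsetSum (Finset.range p) fun k _ => hterm k
  simp only [← Finset.mul_sum, Finset.sum_const_zero] at hsum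
  exact hsum.comp (tendsto_id.const_mul_atTop hσ)

lemma gammaPDF_natCast_succ (p : ℕ) (σ : ℝ) {t : ℝ} (ht : 0 ≤ t) :
    gammaPDF ((p + 1 : ℕ) : ℝ) σ t =
      ENNReal.ofReal (σ * (erlangSurvival (p + 1) σ t - erlangSurvival p σ t)) := by
  rw [gammaPDF_of_nonneg ht, erlangSurvival_succ, Real.rpow_natCast, Nat.cast_succ,
    Real.Gamma_nat_eq_factorial, add_sub_cancel_right, Real.rpow_natCast]
  congr 1
  ring

lemma erlangMeasure_Ioi {p : ℕ} (hp : p ≠ 0) {σ : ℝ} (hσ : 0 < σ) {x : ℝ} (hx : 0 ≤ x) :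
    erlangMeasure p σ (Set.Ioi x) = ENNReal.ofReal (erlangSurvival p σ x) := by
  obtain ⟨p, rfl⟩ := Nat.exists_eq_succ_of_ne_zero hp
  have hnonneg (t : ℝ) (ht : t ∈ Set.Ioi x) :
      0 ≤ σ * (erlangSurvival (p + 1) σ t - erlangSurvival p σ t) :=
    mul_nonneg hσ.le (sub_nonneg.2 (erlangSurvival_mono hσ.le (hx.trans (le_of_lt ht)) p.le_succ))
  have hderiv (t : ℝ) (_ : t ∈ Set.Ici x) : HasDerivAt (fun t => -erlangSurvival (p + 1) σ t)
      (σ * (erlangSurvival (p + 1) σ t - erlangSurvival p σ t)) t :=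
    (hasDerivAt_erlangSurvival_succ p σ t).neg.congr_deriv (neg_neg _)
  have hlim : Tendsto (fun t => -erlangSurvival (p + 1) σ t) atTop (𝓝 0) := by
    simpa using (tendsto_erlangSurvival_atTop (p + 1) hσ).neg
  have hint := integrableOn_Ioi_deriv_of_nonneg' hderiv hnonneg hlim
  rw [erlangMeasure, gammaMeasure, withDensity_apply _ measurableSet_Ioi,
    setLIntegral_congr_fun measurableSet_Ioi
      fun t ht => gammaPDF_natCast_succ p σ (hx.trans (le_of_lt ht)),
    ← ofReal_integral_eq_lintegral_ofReal hint
      ((ae_restrict_iff' measurableSet_Ioi).2 (ae_of_all _ hnonneg)),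
    integral_Ioi_of_hasDerivAt_of_tendsto' hderiv hint hlim, zero_sub, neg_neg]

lemma erlangMeasure_one (σ : ℝ) : erlangMeasure 1 σ = expMeasure σ := by
  rw [erlangMeasure, Nat.cast_one, expMeasure]

lemma ae_nonneg_erlangMeasure (p : ℕ) (σ : ℝ) : ∀ᵐ x ∂erlangMeasure p σ, 0 ≤ x := by
  have hIio : erlangMeasure p σ (Set.Iio 0) = 0 := by
    rw [erlangMeasure, gammaMeasure, withDensity_apply _ measurableSet_Iio,
      lintegral_gammaPDF_of_nonpos le_rfl]
  filter_upwards [measure_eq_zero_iff_ae_notMem.1 hIio] with x hx using not_lt.1 hx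

end ErlangMeasure

section Generator

open scoped Matrix.Norms.Operator in
lemma exp_mul_eq_mul_exp_of_mul_eq {m n : Type*} [Fintype m] [Fintype n] [DecidableEq m]
    [DecidableEq n] {Q : Matrix m m ℝ} {A : Matrix n n ℝ} {J : Matrix m n ℝ} (h : Q * J = J * A) :
    exp Q * J = J * exp A := by
  have hpow (k : ℕ) : Q ^ k * J = J * A ^ k := by
    induction k with
    | zero => rw [pow_zero, pow_zero, Matrix.one_mul, Matrix.mul_one]
    | succ k ih =>
      rw [pow_succ, Matrix.mul_assoc, h, ← Matrix.mul_assoc, ih, Matrix.mul_assoc, ← pow_succ]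
  have hQ := (NormedSpace.exp_series_hasSum_exp' (𝕂 := ℝ) Q).map (Matrix.addMonoidHomMulRight J)
    (continuous_id.matrix_mul continuous_const)
  have hA := (NormedSpace.exp_series_hasSum_exp' (𝕂 := ℝ) A).map (Matrix.addMonoidHomMulLeft J)
    (continuous_const.matrix_mul continuous_id)
  refine hQ.unique (hA.congr_fun fun k => ?_)
  simp [hpow]

variable {p : ℕ} (A : Matrix (Fin p) (Fin p) ℝ)

/-- The matrix of the inclusion `some` of the states other than `⋆`, which intertwines
`generator A` with `A`. -/
def someMatrix (p : ℕ) : Matrix (Option (Fin p)) (Fin p) ℝ :=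
  Matrix.submatrix 1 id some

lemma mul_someMatrix (Q : Matrix (Option (Fin p)) (Option (Fin p)) ℝ) (x : Option (Fin p))
    (j : Fin p) : (Q * someMatrix p) x j = Q x (some j) := by
  simp [someMatrix, Matrix.mul_apply, Matrix.one_apply]

lemma someMatrix_mul_none (j : Fin p) : (someMatrix p * A) none j = 0 := by
  simp [someMatrix, Matrix.mul_apply]

lemma someMatrix_mul_some (i j : Fin p) : (someMatrix p * A) (some i) j = A i j := by
  simp [someMatrix, Matrix.mul_apply, Matrix.one_apply]

lemma exp_generator_mul_someMatrix (t : ℝ) :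
    exp (t • generator A) * someMatrix p = someMatrix p * exp (t • A) := by
  refine exp_mul_eq_mul_exp_of_mul_eq (Matrix.ext fun x j => ?_)
  cases x with
  | none => simp [mul_someMatrix, someMatrix_mul_none, generator]
  | some i => simp [mul_someMatrix, someMatrix_mul_some, generator]

lemma exp_generator_none_some (t : ℝ) (j : Fin p) : exp (t • generator A) none (some j) = 0 := by
  rw [← mul_someMatrix (exp _), exp_generator_mul_someMatrix, someMatrix_mul_none]

lemma exp_generator_some_some (t : ℝ) (i j : Fin p) :
    exp (t • generator A) (some i) (some j) = exp (t • A) i j := by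
  rw [← mul_someMatrix (exp _), exp_generator_mul_someMatrix, someMatrix_mul_some]

end Generator

section JumpProcess

lemma absorptionTime_nonneg {Ω : Type*} {p : ℕ} (φ : ℝ≥0 → Ω → Option (Fin p)) (ω : Ω) :
    0 ≤ absorptionTime φ ω := by
  refine le_sInf ?_
  rintro _ ⟨t, -, rfl⟩
  exact EReal.coe_nonneg.2 t.2

lemma lt_absorptionTime_iff {Ω : Type*} {p : ℕ} {φ : ℝ≥0 → Ω → Option (Fin p)} {ω : Ω}
    {x : ℝ≥0} (hright : ∀ᶠ s in 𝓝[≥] x, φ s ω = φ x ω)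
    (habs : ∀ s ≤ x, φ s ω = none → φ x ω = none) :
    ((x : ℝ) : EReal) < absorptionTime φ ω ↔ φ x ω ≠ none := by
  refine ⟨fun h hx => (sInf_le ⟨x, hx, rfl⟩ : absorptionTime φ ω ≤ _).not_gt h, fun hx => ?_⟩
  obtain ⟨u, hxu, hu⟩ := mem_nhdsGE_iff_exists_Ico_subset.1 hright
  refine (EReal.coe_lt_coe_iff.2 (NNReal.coe_lt_coe.2 hxu)).trans_le (le_sInf ?_)
  rintro _ ⟨s, hs, rfl⟩
  rw [EReal.coe_le_coe_iff, NNReal.coe_le_coe]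
  by_contra! hsu
  rcases le_total s x with hsx | hxs
  · exact hx (habs s hsx hs)
  · exact hx ((hu ⟨hxs, hsu⟩).symm.trans hs)

variable {Ω : Type*} [MeasurableSpace Ω] {P : Measure Ω}

lemma IsMarkovJumpProcess.measureReal_eq [IsFiniteMeasure P] {E : Type*} [Fintype E]
    [DecidableEq E] {π : E → ℝ} {Q : Matrix E E ℝ} {φ : ℝ≥0 → Ω → E}
    (hφ : IsMarkovJumpProcess P π Q φ) (x : ℝ≥0) (j : E) :
    P.real {ω | φ x ω = j} = (π ᵥ* exp ((x : ℝ) • Q)) j := by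
  have hpair (i : E) : P.real {ω | φ 0 ω = i ∧ φ x ω = j} = π i * exp ((x : ℝ) • Q) i j := by
    have h := hφ.finite_dim 1 ![0, x] ![i, j] rfl (Fin.monotone_iff_le_succ.2 (by simp))
    simpa [Fin.forall_fin_two] using h
  have hmeas (i : E) : MeasurableSet {ω | φ 0 ω = i ∧ φ x ω = j} :=
    (hφ.measurableSet_eq 0 i).inter (hφ.measurableSet_eq x j)
  have hunion : {ω | φ x ω = j} = ⋃ i ∈ Finset.univ, {ω | φ 0 ω = i ∧ φ x ω = j} := by
    ext ω
    simp
  rw [hunion, measureReal_biUnion_finset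
    (fun a _ b _ hab => Set.disjoint_left.2 fun ω ha hb => hab (ha.1.symm.trans hb.1))
    fun i _ => hmeas i]
  exact Finset.sum_congr rfl fun i _ => hpair i

variable {p : ℕ} {A : Matrix (Fin p) (Fin p) ℝ} {α : Fin p → ℝ} {φ : ℝ≥0 → Ω → Option (Fin p)}

variable [IsFiniteMeasure P]

lemma IsMarkovJumpProcess.ae_eq_none_of_le
    (hφ : IsMarkovJumpProcess P (initialVector α) (generator A) φ) {s x : ℝ≥0} (hsx : s ≤ x) :
    ∀ᵐ ω ∂P, φ s ω = none → φ x ω = none := by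
  have hnull (i : Option (Fin p)) (j : Fin p) :
      ∀ᵐ ω ∂P, ¬(φ 0 ω = i ∧ φ s ω = none ∧ φ x ω = some j) := by
    have h := hφ.finite_dim 2 ![0, s, x] ![i, none, some j] rfl
      (Fin.monotone_iff_le_succ.2 (by simp [Fin.forall_fin_two, hsx]))
    have hzero : P.real {ω | φ 0 ω = i ∧ φ s ω = none ∧ φ x ω = some j} = 0 := by
      simpa [Fin.forall_fin_succ, Fin.prod_univ_two, exp_generator_none_some] using h
    rw [measureReal_eq_zero_iff] at hzero
    exact measure_eq_zero_iff_ae_notMem.1 hzero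
  filter_upwards [ae_all_iff.2 fun i => ae_all_iff.2 (hnull i)] with ω hω hs
  by_contra hx
  obtain ⟨j, hj⟩ := Option.ne_none_iff_exists'.1 hx
  exact hω (φ 0 ω) j ⟨rfl, hs, hj⟩

lemma IsMarkovJumpProcess.ae_forall_le_eq_none
    (hφ : IsMarkovJumpProcess P (initialVector α) (generator A) φ) (x : ℝ≥0) :
    ∀ᵐ ω ∂P, ∀ s ≤ x, φ s ω = none → φ x ω = none := by
  obtain ⟨D, hDcount, hDdense⟩ := TopologicalSpace.exists_countable_dense ℝ≥0
  have hD : ∀ᵐ ω ∂P, ∀ q ∈ D, q ≤ x → φ q ω = none → φ x ω = none := by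
    rw [ae_ball_iff hDcount]
    intro q _
    by_cases hq : q ≤ x
    · simpa [hq] using hφ.ae_eq_none_of_le hq
    · simp [hq]
  filter_upwards [hD] with ω hω s hsx hs
  obtain rfl | hsx := hsx.eq_or_lt
  · exact hs
  obtain ⟨u, hsu, hu⟩ := mem_nhdsGE_iff_exists_Ico_subset.1 (hφ.right_continuous ω s)
  obtain ⟨q, hqD, hsq, hq⟩ := hDdense.exists_between (lt_min hsu hsx)
  exact hω q hqD (hq.le.trans (min_le_right _ _))
    ((hu ⟨hsq.le, hq.trans_le (min_le_left _ _)⟩).trans hs)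

lemma IsMarkovJumpProcess.measureReal_ne_none
    (hφ : IsMarkovJumpProcess P (initialVector α) (generator A) φ) (x : ℝ≥0) :
    P.real {ω | φ x ω ≠ none} = α ⬝ᵥ exp ((x : ℝ) • A) *ᵥ 1 := by
  have hunion : {ω | φ x ω ≠ none} = ⋃ j ∈ Finset.univ, {ω | φ x ω = some j} := by
    ext ω
    simp [Option.ne_none_iff_exists']
  have hstate (j : Fin p) : P.real {ω | φ x ω = some j} = (α ᵥ* exp ((x : ℝ) • A)) j := by
    simp [hφ.measureReal_eq, Matrix.vecMul, dotProduct, Fintype.sum_option, initialVector,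
      exp_generator_some_some]
  rw [hunion, measureReal_biUnion_finset
    (fun a _ b _ hab => Set.disjoint_left.2 fun ω ha hb =>
      hab (Option.some_injective _ (ha.symm.trans hb)))
    fun j _ => hφ.measurableSet_eq x (some j)]
  simp only [hstate, Matrix.dotProduct_mulVec, dotProduct_one]

lemma IsMarkovJumpProcess.measure_lt_absorptionTime
    (hφ : IsMarkovJumpProcess P (initialVector α) (generator A) φ) (x : ℝ≥0) :
    P {ω | ((x : ℝ) : EReal) < absorptionTime φ ω} =
      ENNReal.ofReal (α ⬝ᵥ exp ((x : ℝ) • A) *ᵥ 1) := by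
  rw [← hφ.measureReal_ne_none x, ofReal_measureReal]
  refine measure_congr ?_
  filter_upwards [hφ.ae_forall_le_eq_none x] with ω hω
  exact propext (lt_absorptionTime_iff (hφ.right_continuous ω x) hω)

end JumpProcess

section StochasticOrder

variable {Ω₁ Ω₂ : Type*} [MeasurableSpace Ω₁] [MeasurableSpace Ω₂] {P₁ : Measure Ω₁}
  {P₂ : Measure Ω₂}

lemma stochLE_of_forall_nonneg [IsProbabilityMeasure P₁] [IsProbabilityMeasure P₂] {X : Ω₁ → ℝ}
    {Y : Ω₂ → ℝ} (hY : ∀ᵐ ω ∂P₂, 0 ≤ Y ω)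
    (h : ∀ x, 0 ≤ x → P₁ {ω | x < X ω} ≤ P₂ {ω | x < Y ω}) : StochLE X P₁ Y P₂ := by
  intro x
  rcases le_or_gt 0 x with hx | hx
  · exact h x hx
  · calc P₁ {ω | x < X ω} ≤ 1 := prob_le_one
      _ = P₂ Set.univ := measure_univ.symm
      _ ≤ P₂ {ω | x < Y ω} :=
        measure_mono_ae (by filter_upwards [hY] with ω hω _ using hx.trans_le hω)

lemma measure_lt_of_hasLaw_erlangMeasure {p : ℕ} {σ : ℝ} {H : Ω₁ → ℝ}
    (hH : HasLaw H (erlangMeasure p σ) P₁) (hp : p ≠ 0) (hσ : 0 < σ) {x : ℝ} (hx : 0 ≤ x) :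
    P₁ {ω | x < H ω} = ENNReal.ofReal (erlangSurvival p σ x) :=
  (hH.measure_eq (p := (x < ·)) measurableSet_Ioi).trans (erlangMeasure_Ioi hp hσ hx)

variable {p : ℕ} {A : Matrix (Fin p) (Fin p) ℝ} {α : Fin p → ℝ} {Y : Ω₁ → ℝ}

lemma IsPhaseType.measure_lt (hY : IsPhaseType.{w, _} α A Y P₁) {x : ℝ} (hx : 0 ≤ x) :
    P₁ {ω | x < Y ω} = ENNReal.ofReal (α ⬝ᵥ exp (x • A) *ᵥ 1) := by
  obtain ⟨Ω', _, P', _, φ, hφ, hid⟩ := hY.law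
  lift x to ℝ≥0 using hx
  rw [← hφ.measure_lt_absorptionTime x]
  simpa [Set.preimage] using hid.measure_mem_eq (measurableSet_Ioi (a := ((x : ℝ) : EReal)))

lemma IsPhaseType.ae_nonneg (hY : IsPhaseType.{w, _} α A Y P₁) : ∀ᵐ ω ∂P₁, 0 ≤ Y ω := by
  obtain ⟨Ω', _, P', _, φ, -, hid⟩ := hY.law
  have h := hid.symm.ae_snd (p := (0 ≤ ·)) measurableSet_Ici
    (ae_of_all _ (absorptionTime_nonneg φ))
  simpa only [EReal.coe_nonneg] using h

lemma IsPhaseType.neZero (hY : IsPhaseType.{w, _} α A Y P₁) : NeZero p :=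
  ⟨by rintro rfl; simpa using hY.initial_sum⟩

lemma IsPhaseType.dotProduct_const (hY : IsPhaseType.{w, _} α A Y P₁) (c : ℝ) :
    α ⬝ᵥ (fun _ => c) = c := by
  rw [dotProduct, ← Finset.sum_mul, hY.initial_sum, one_mul]

variable [IsProbabilityMeasure P₁] [IsProbabilityMeasure P₂]

theorem IsPhaseType.stochLE_of_hasLaw_expMeasure (hY : IsPhaseType.{w, _} α A Y P₁) {ν : ℝ}
    (hν : 0 < ν) (hA : ∀ i, exitRate A i ≤ ν) {L : Ω₂ → ℝ} (hL : HasLaw L (expMeasure ν) P₂) :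
    StochLE L P₂ Y P₁ := by
  refine stochLE_of_forall_nonneg hY.ae_nonneg fun x hx => ?_
  rw [← erlangMeasure_one] at hL
  rw [hY.measure_lt hx, measure_lt_of_hasLaw_erlangMeasure hL one_ne_zero hν hx]
  refine ENNReal.ofReal_le_ofReal ?_
  calc erlangSurvival 1 ν x = α ⬝ᵥ fun _ => Real.exp (-(ν * x)) := by
        simp [erlangSurvival, hY.dotProduct_const]
    _ ≤ α ⬝ᵥ exp (x • A) *ᵥ 1 := dotProduct_le_dotProduct_of_nonneg_left
        (hY.subGenerator.isMetzler.exp_neg_mul_le_exp_smul_mulVec_one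
          (fun i => by simpa [mulVec_one_apply_eq_neg_exitRate] using hA i) hx) hY.initial_nonneg

theorem IsPhaseType.stochLE_of_hasLaw_erlangMeasure (hY : IsPhaseType.{w, _} α A Y P₁) {σ : ℝ}
    (hσ : 0 < σ) (hA : ∀ r, -σ < r → ¬A.charpoly.IsRoot r) {q : ℕ} (hq : p ≤ q) {H : Ω₂ → ℝ}
    (hH : HasLaw H (erlangMeasure q σ) P₂) : StochLE Y P₁ H P₂ := by
  have hH_nonneg : ∀ᵐ ω ∂P₂, 0 ≤ H ω :=
    (hH.ae_iff (measurableSet_setOfPred.1 measurableSet_Ici)).2 (ae_nonneg_erlangMeasure q σ)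
  refine stochLE_of_forall_nonneg hH_nonneg fun x hx => ?_
  have hq0 : q ≠ 0 := (hY.neZero.pos.trans_le hq).ne'
  rw [hY.measure_lt hx, measure_lt_of_hasLaw_erlangMeasure hH hq0 hσ hx]
  refine ENNReal.ofReal_le_ofReal ?_
  calc α ⬝ᵥ exp (x • A) *ᵥ 1 ≤ α ⬝ᵥ fun _ => erlangSurvival p σ x :=
        dotProduct_le_dotProduct_of_nonneg_left
          (fun i => by
            simpa using hY.subGenerator.isMetzler.exp_smul_mulVec_one_le_erlangSurvival_of_charpoly
              hY.subGenerator.mulVec_one_nonpos hσ hA hx i) hY.initial_nonneg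
    _ = erlangSurvival p σ x := hY.dotProduct_const _
    _ ≤ erlangSurvival q σ x := erlangSurvival_mono hσ.le hx hq

end StochasticOrder

end PhaseType

theorem mainTheorem6
    {ΩY ΩL ΩH : Type*} [MeasurableSpace ΩY] [MeasurableSpace ΩL] [MeasurableSpace ΩH]
    {PY : Measure ΩY} {PL : Measure ΩL} {PH : Measure ΩH}
    [IsProbabilityMeasure PY] [IsProbabilityMeasure PL] [IsProbabilityMeasure PH]
    {p₀ : ℕ} {α : Fin p₀ → ℝ} {A : Matrix (Fin p₀) (Fin p₀) ℝ}
    {Y : ΩY → ℝ} (hY : PhaseType.IsPhaseType.{w, _} α A Y PY)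
    {z : ℂ} (hz : PhaseType.IsDominantEigenvalue A z)
    {σ₀ : ℝ} (hσ₀ : z.re = -σ₀)
    {ν₀ : ℝ} (hν₀ : IsGreatest (Set.range (PhaseType.exitRate A)) ν₀)
    {ν : ℝ} (hν : ν₀ ≤ ν) {p : ℕ} (hp : p₀ ≤ p) {σ : ℝ} (hσ_pos : 0 < σ) (hσ : σ ≤ σ₀)
    {L : ΩL → ℝ} (hL : HasLaw L (expMeasure ν) PL)
    {H : ΩH → ℝ} (hH : HasLaw H (PhaseType.erlangMeasure p σ) PH) :
    PhaseType.StochLE L PL Y PY ∧ PhaseType.StochLE Y PY H PH := by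
  have hroot (r : ℝ) (hr : -σ < r) : ¬A.charpoly.IsRoot r :=
    hz.not_isRoot_charpoly (by linarith)
  have hexit (i : Fin p₀) : PhaseType.exitRate A i ≤ ν := (hν₀.2 ⟨i, rfl⟩).trans hν
  have hν_pos : 0 < ν := by
    have := hY.neZero
    obtain ⟨i, hi⟩ := PhaseType.exists_exitRate_ne_zero (hroot 0 (neg_lt_zero.2 hσ_pos))
    exact ((hY.subGenerator.exitRate_nonneg i).lt_of_ne' hi).trans_le (hexit i)
  exact ⟨hY.stochLE_of_hasLaw_expMeasure hν_pos hexit hL,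
    hY.stochLE_of_hasLaw_erlangMeasure hσ_pos hroot hp hH⟩
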